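/- For $n\ge 0$ let $\mathcal F_n$ be the set of sequences $f=(\tau_1,\dots,\tau_n)$ of transpositions of $\{0,1,\dots,n\}$ whose product, multiplied from left to right, is the full cycle $(0\,1\,\cdots\,n)$. Write $\tau_i=(a_i\,b_i)$ with $a_i<b_i$, and put $$\mathrm{area}_L(f)=\binom n2-\sum_{i=1}^n a_i,\qquad \mathrm{area}_U(f)=\sum_{i=1}^n b_i-\binom n2 .$$ Then $\mathrm{area}_L(f)\ge 0$ and $\mathrm{area}_U(f)\ge 0$ for all $n\ge 0$ and all $f\in\mathcal F_n$. Moreover, the polynomials $F_n(q,t)=\sum_{f\in\mathcal F_n} q^{\mathrm{area}_L(f)}t^{\mathrm{area}_U(f)}$ and their exponential generating series $F(x;q,t)=\sum_{n\ge 0}F_n(q,t)\,\frac{x^n}{n!}$ satisfy, as formal power series in $x$ over $\mathbb Q[q,t]$, $$F(x;q,t)=\exp\Bigl(t\sum_{n\ge 1}\bigl(t^{n-1}+t^{n-2}q+\cdots+q^{n-1}\bigr)F_{n-1}(q,t)\,\frac{x^n}{n!}\Bigr).$$ -/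

import Mathlib

namespace MinFact

/-- The canonical full cycle `(0 1 ⋯ n)` on `{0, 1, …, n}`, i.e. `i ↦ i + 1` and `n ↦ 0`. -/
def canonicalCycle (n : ℕ) : Equiv.Perm (Fin (n + 1)) := finRotate (n + 1)

/-- The product `τ₁ τ₂ ⋯ τₘ` multiplied from left to right: `i ↦ τₘ(⋯ τ₂(τ₁(i)) ⋯)`.
Mathlib composes permutations from right to left, whence the reversal. -/
def leftToRightProd {n m : ℕ} (τ : Fin m → Equiv.Perm (Fin (n + 1))) : Equiv.Perm (Fin (n + 1)) :=
  (List.ofFn τ).reverse.prod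

open Classical in
/-- The set of minimal factorizations of `(0 1 ⋯ n)`: sequences of `n` transpositions of
`{0, …, n}` whose left-to-right product is `(0 1 ⋯ n)`. -/
noncomputable def minimalFactorizations (n : ℕ) : Finset (Fin n → Equiv.Perm (Fin (n + 1))) :=
  {τ | (∀ i, (τ i).IsSwap) ∧ leftToRightProd τ = canonicalCycle n}

/-- The smaller element `a` moved by a transposition `(a b)`, `a < b`. -/
noncomputable def lower {n : ℕ} (π : Equiv.Perm (Fin (n + 1))) : Fin (n + 1) := π.support.inf id

/-- The larger element `b` moved by a transposition `(a b)`, `a < b`. -/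
noncomputable def upper {n : ℕ} (π : Equiv.Perm (Fin (n + 1))) : Fin (n + 1) := π.support.sup id

theorem lower_swap {n : ℕ} {a b : Fin (n + 1)} (h : a < b) : lower (Equiv.swap a b) = a := by
  simp [lower, Equiv.Perm.support_swap h.ne, h.le]

theorem upper_swap {n : ℕ} {a b : Fin (n + 1)} (h : a < b) : upper (Equiv.swap a b) = b := by
  simp [upper, Equiv.Perm.support_swap h.ne, h.le]

/-- The lower area `C(n,2) - (a₁ + ⋯ + aₙ)`, as an integer. -/
noncomputable def areaL {n : ℕ} (τ : Fin n → Equiv.Perm (Fin (n + 1))) : ℤ :=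
  (n.choose 2 : ℤ) - ∑ i, ((lower (τ i) : ℕ) : ℤ)

/-- The upper area `(b₁ + ⋯ + bₙ) - C(n,2)`, as an integer. -/
noncomputable def areaU {n : ℕ} (τ : Fin n → Equiv.Perm (Fin (n + 1))) : ℤ :=
  ∑ i, ((upper (τ i) : ℕ) : ℤ) - (n.choose 2 : ℤ)

/-- The polynomial ring `ℚ[q, t]`. -/
abbrev Coeff : Type := MvPolynomial (Fin 2) ℚ

/-- The indeterminate `q`. -/
noncomputable def q : Coeff := MvPolynomial.X 0

/-- The indeterminate `t`. -/
noncomputable def t : Coeff := MvPolynomial.X 1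

/-- `F_n(q,t) = ∑ q^{area_L(f)} t^{area_U(f)}` over the minimal factorizations `f` of `(0 1 ⋯ n)`.
The main theorem also asserts that the exponents are nonnegative, so `Int.toNat` loses nothing. -/
noncomputable def F (n : ℕ) : Coeff :=
  ∑ f ∈ minimalFactorizations n, q ^ (areaL f).toNat * t ^ (areaU f).toNat

/-- `t^{n-1} + t^{n-2} q + ⋯ + q^{n-1}`, which is the empty sum `0` for `n = 0`. -/
noncomputable def qtNumber (n : ℕ) : Coeff :=
  ∑ i ∈ Finset.range n, t ^ (n - 1 - i) * q ^ i

/-- The exponential generating series `∑_{n ≥ 0} a_n xⁿ / n!`. -/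
noncomputable def egf (a : ℕ → Coeff) : PowerSeries Coeff :=
  PowerSeries.mk fun n => (1 / (n.factorial : ℚ)) • a n

/-- The series `t ∑_{n ≥ 1} (t^{n-1} + t^{n-2} q + ⋯ + q^{n-1}) F_{n-1}(q,t) xⁿ / n!`.
The term `n = 0` is zero because `qtNumber 0 = 0`. -/
noncomputable def exponent : PowerSeries Coeff :=
  PowerSeries.C t * egf fun n => qtNumber n * F (n - 1)

/-- The exponent has zero constant term, so it may be substituted into the exponential series. -/
theorem hasSubst_exponent : PowerSeries.HasSubst exponent := by
  apply PowerSeries.HasSubst.of_constantCoeff_zero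
  change PowerSeries.constantCoeff exponent = 0
  simp [exponent, egf, qtNumber]

end MinFact

/-!
Encode a factorization of the cycle `(0 1 ⋯ N)` by the list of its arcs `(a, b)`, `a < b`, and
follow the point `N` along the partial products: it starts at `N`, ends at `0`, and never moves up.
Each arc `(u, u + k + 1)` that moves it down cuts the factorization in two: the other arcs are
noncrossing with it, and collapsing either side of it leaves a factorization of `(0 1 ⋯ k)`, whose
two parts before and after the cut have been exchanged, and one of `(0 1 ⋯ n)`, where
`N = n + k + 1`. The places at which these two are cut and the shuffle of their parts are
arbitrary, and they determine `u`. Cutting once gives, by induction, that the areas are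
nonnegative. The lengths `k + 1` of the jumps add up to `N`, so summing them over all factorizations
gives `N F_N = ∑ C(N, k + 1) (k + 1) t (t^k + ⋯ + q^k) F_k F_n`, which is the differential equation
`F' = g' F` for the exponent `g`.
-/

namespace MinFact

/-! ### Factorizations as lists of arcs -/

/-- A pair `(a, b)` with `a < b ≤ n`, encoding the transposition `(a b)` of `{0, …, n}`. -/
def IsArc (n : ℕ) (e : ℕ × ℕ) : Prop := e.1 < e.2 ∧ e.2 ≤ n

/-- One of the two coordinates of an arc, so that lower and upper endpoints can be treated
alike. -/
def IsEndpoint (p : ℕ × ℕ → ℕ) : Prop := p = Prod.fst ∨ p = Prod.snd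

theorem IsEndpoint.fst : IsEndpoint Prod.fst := Or.inl rfl

theorem IsEndpoint.snd : IsEndpoint Prod.snd := Or.inr rfl

theorem IsEndpoint.map {p : ℕ × ℕ → ℕ} (hp : IsEndpoint p) (f : ℕ → ℕ) (e : ℕ × ℕ) :
    p (e.map f f) = f (p e) := by
  rcases hp with rfl | rfl <;> rfl

theorem IsEndpoint.le {p : ℕ × ℕ → ℕ} (hp : IsEndpoint p) {n : ℕ} {e : ℕ × ℕ} (he : IsArc n e) :
    p e ≤ e.2 := by
  rcases hp with rfl | rfl
  exacts [he.1.le, le_rfl]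

/-- The left-to-right product of the transpositions encoded by a list of arcs, as a permutation
of `ℕ`, so that it makes sense without fixing `n`. -/
def arcProd (L : List (ℕ × ℕ)) : Equiv.Perm ℕ :=
  (L.map fun e => Equiv.swap e.1 e.2).reverse.prod

/-- The cycle `(0 1 ⋯ n)` as a permutation of `ℕ`. -/
def cycle (n : ℕ) : Equiv.Perm ℕ := (List.range (n + 1)).formPerm

/-- A minimal factorization of `(0 1 ⋯ n)`, as the list of its arcs. -/
structure IsMinFactorization (n : ℕ) (L : List (ℕ × ℕ)) : Prop where
  length_eq : L.length = n
  isArc : ∀ e ∈ L, IsArc n e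
  prod_eq : arcProd L = cycle n

@[simp] theorem arcProd_nil : arcProd [] = 1 := rfl

@[simp] theorem arcProd_cons (e : ℕ × ℕ) (L : List (ℕ × ℕ)) :
    arcProd (e :: L) = arcProd L * Equiv.swap e.1 e.2 := by
  simp [arcProd]

@[simp] theorem arcProd_append (A B : List (ℕ × ℕ)) :
    arcProd (A ++ B) = arcProd B * arcProd A := by
  simp [arcProd]

theorem arcProd_le {n : ℕ} {L : List (ℕ × ℕ)} (hL : ∀ e ∈ L, IsArc n e) {x : ℕ} (hx : x ≤ n) :
    arcProd L x ≤ n := by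
  induction L generalizing x with
  | nil => exact hx
  | cons e L ih =>
    obtain ⟨⟨h₁, h₂⟩, hL⟩ := List.forall_mem_cons.1 hL
    rw [arcProd_cons, Equiv.Perm.mul_apply]
    refine ih hL ?_
    rw [Equiv.swap_apply_def]
    split_ifs <;> omega

theorem arcProd_of_lt {n : ℕ} {L : List (ℕ × ℕ)} (hL : ∀ e ∈ L, IsArc n e) {x : ℕ} (hx : n < x) :
    arcProd L x = x := by
  induction L with
  | nil => rfl
  | cons e L ih =>
    obtain ⟨⟨h₁, h₂⟩, hL⟩ := List.forall_mem_cons.1 hL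
    rw [arcProd_cons, Equiv.Perm.mul_apply,
      Equiv.swap_apply_of_ne_of_ne (by omega) (by omega), ih hL]

theorem cycle_apply (n x : ℕ) :
    cycle n x = if x < n then x + 1 else if x = n then 0 else x := by
  by_cases hx : x ≤ n
  · have h := List.formPerm_apply_getElem (List.range (n + 1)) List.nodup_range x
      (by simpa using Nat.lt_succ_of_le hx)
    simp only [List.getElem_range, List.length_range] at h
    rw [cycle, h]
    split_ifs with hlt heq
    · exact Nat.mod_eq_of_lt (by omega)
    · simp [heq]
    · omega
  · rw [cycle, List.formPerm_apply_of_notMem (by simpa using by omega)]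
    split_ifs <;> omega

theorem eq_of_apply_cycle {α : Type*} {n : ℕ} {f : ℕ → α} (hf : ∀ y ≤ n, f (cycle n y) = f y)
    {x : ℕ} (hx : x ≤ n) : f x = f 0 := by
  induction x with
  | zero => rfl
  | succ x ih =>
    rw [← ih (by omega), ← hf x (by omega), cycle_apply, if_pos (by omega)]

/-! ### Rotation -/

/-- The arc of the transposition `(a b)` conjugated by `(0 1 ⋯ n)`. -/
def rotateArc (n : ℕ) (e : ℕ × ℕ) : ℕ × ℕ :=
  if e.2 < n then (e.1 + 1, e.2 + 1) else (0, e.1 + 1)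

theorem IsArc.rotateArc {n : ℕ} {e : ℕ × ℕ} (he : IsArc n e) : IsArc n (rotateArc n e) := by
  obtain ⟨h₁, h₂⟩ := he
  unfold MinFact.rotateArc
  split_ifs
  · exact ⟨by simpa using h₁, by simpa⟩
  · exact ⟨by simp, by simp only; omega⟩

theorem swap_rotateArc {n : ℕ} {e : ℕ × ℕ} (he : IsArc n e) :
    Equiv.swap (rotateArc n e).1 (rotateArc n e).2 =
      cycle n * Equiv.swap e.1 e.2 * (cycle n)⁻¹ := by
  obtain ⟨h₁, h₂⟩ := he
  rw [← Equiv.swap_apply_apply, cycle_apply, cycle_apply, if_pos (by omega), rotateArc]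
  split_ifs
  · rfl
  · exact Equiv.swap_comm _ _
  · omega

theorem arcProd_map_rotateArc {n : ℕ} {L : List (ℕ × ℕ)} (hL : ∀ e ∈ L, IsArc n e) :
    arcProd (L.map (rotateArc n)) = cycle n * arcProd L * (cycle n)⁻¹ := by
  induction L with
  | nil => simp
  | cons e L ih =>
    obtain ⟨he, hL⟩ := List.forall_mem_cons.1 hL
    rw [List.map_cons, arcProd_cons, arcProd_cons, ih hL, swap_rotateArc he]
    group

theorem isMinFactorization_append_iff_rotate {n : ℕ} {A B : List (ℕ × ℕ)}
    (hA : ∀ e ∈ A, IsArc n e) :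
    IsMinFactorization n (A ++ B) ↔ IsMinFactorization n (B ++ A.map (rotateArc n)) := by
  have hprod : arcProd (A ++ B) = cycle n ↔ arcProd (B ++ A.map (rotateArc n)) = cycle n := by
    rw [arcProd_append, arcProd_append, arcProd_map_rotateArc hA, mul_assoc, mul_assoc,
      mul_eq_left, mul_eq_one_iff_eq_inv', inv_mul_eq_iff_eq_mul, eq_mul_inv_iff_mul_eq]
  have hA' : ∀ e ∈ A.map (rotateArc n), IsArc n e :=
    List.forall_mem_map.2 fun e he => (hA e he).rotateArc
  constructor
  · rintro ⟨hlen, harc, h⟩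
    exact ⟨by simpa [add_comm] using hlen,
      List.forall_mem_append.2 ⟨(List.forall_mem_append.1 harc).2, hA'⟩, hprod.1 h⟩
  · rintro ⟨hlen, harc, h⟩
    exact ⟨by simpa [add_comm] using hlen,
      List.forall_mem_append.2 ⟨hA, (List.forall_mem_append.1 harc).1⟩, hprod.2 h⟩

/-! ### Connectivity -/

theorem exists_classes_of_arcs {α : Type*} [DecidableEq α] (L : List (α × α)) (s : Finset α) :
    ∃ ρ : α → α, (∀ e ∈ L, ρ e.1 = ρ e.2) ∧ s.card ≤ (s.image ρ).card + L.length := by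
  induction L with
  | nil => exact ⟨id, by simp, by simp⟩
  | cons e L ih =>
    obtain ⟨ρ, hρ, hcard⟩ := ih
    let σ : α → α := fun x => if x = ρ e.1 then ρ e.2 else x
    refine ⟨σ ∘ ρ, List.forall_mem_cons.2 ⟨?_, fun e' he' => congrArg σ (hρ e' he')⟩, ?_⟩
    · simp [σ]
    · have hsub : (s.image ρ).erase (ρ e.1) ⊆ s.image (σ ∘ ρ) := by
        simp only [Finset.subset_iff, Finset.mem_erase, Finset.mem_image]
        rintro _ ⟨hne, x, hx, rfl⟩
        exact ⟨x, hx, if_neg hne⟩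
      have := Finset.card_le_card hsub
      have := Finset.pred_card_le_card_erase (s := s.image ρ) (a := ρ e.1)
      rw [List.length_cons]
      omega

theorem apply_arcProd {α : Type*} {ρ : ℕ → α} {L : List (ℕ × ℕ)} (hρ : ∀ e ∈ L, ρ e.1 = ρ e.2)
    (x : ℕ) : ρ (arcProd L x) = ρ x := by
  induction L generalizing x with
  | nil => rfl
  | cons e L ih =>
    obtain ⟨he, hL⟩ := List.forall_mem_cons.1 hρ
    rw [arcProd_cons, Equiv.Perm.mul_apply, ih hL, Equiv.swap_apply_def]
    split_ifs with h₁ h₂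
    · rw [h₁, he]
    · rw [h₂, he]
    · rfl

theorem card_image_le_one_of_const {α : Type*} [DecidableEq α] {n : ℕ} {ρ : ℕ → α}
    (hρ : ∀ x ≤ n, ρ x = ρ 0) : ((Finset.range (n + 1)).image ρ).card ≤ 1 := by
  have hsub : (Finset.range (n + 1)).image ρ ⊆ {ρ 0} := by
    simp only [Finset.image_subset_iff, Finset.mem_range, Finset.mem_singleton]
    exact fun x hx => hρ x (by omega)
  exact (Finset.card_le_card hsub).trans_eq (Finset.card_singleton _)

theorem le_length_of_arcProd_eq_cycle {n : ℕ} {L : List (ℕ × ℕ)} (hL : arcProd L = cycle n) :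
    n ≤ L.length := by
  obtain ⟨ρ, hρ, hcard⟩ := exists_classes_of_arcs L (Finset.range (n + 1))
  have hone := card_image_le_one_of_const (n := n) fun x hx =>
    eq_of_apply_cycle (fun y _ => hL ▸ apply_arcProd hρ y) hx
  rw [Finset.card_range] at hcard
  omega

/-! ### Placing two families of arcs side by side -/

/-- The increasing map from `ℕ` onto the complement of the block `{c, …, c + k}`. -/
def gap (c k x : ℕ) : ℕ := if x < c then x else x + (k + 1)

/-- Moves arcs of the left kind onto the block `{c, …, c + k}` and arcs of the right kind onto its
complement. -/
def place (c k : ℕ) : (ℕ × ℕ) ⊕ (ℕ × ℕ) → ℕ × ℕ :=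
  Sum.elim (Prod.map (· + c) (· + c)) (Prod.map (gap c k) (gap c k))

/-- Arcs of `{0, …, k}` on the left, arcs of `{0, …, n}` on the right. -/
def IsSumArc (k n : ℕ) : (ℕ × ℕ) ⊕ (ℕ × ℕ) → Prop := Sum.elim (IsArc k) (IsArc n)

/-- The subsequence of left entries. -/
def lefts {α β : Type*} (T : List (α ⊕ β)) : List α := T.filterMap Sum.getLeft?

/-- The subsequence of right entries. -/
def rights {α β : Type*} (T : List (α ⊕ β)) : List β := T.filterMap Sum.getRight?

section LeftsRights

variable {α β : Type*}

@[simp] theorem lefts_nil : lefts ([] : List (α ⊕ β)) = [] := rfl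

@[simp] theorem rights_nil : rights ([] : List (α ⊕ β)) = [] := rfl

@[simp] theorem lefts_cons_inl (a : α) (T : List (α ⊕ β)) :
    lefts (Sum.inl a :: T) = a :: lefts T := rfl

@[simp] theorem lefts_cons_inr (b : β) (T : List (α ⊕ β)) : lefts (Sum.inr b :: T) = lefts T := rfl

@[simp] theorem rights_cons_inl (a : α) (T : List (α ⊕ β)) :
    rights (Sum.inl a :: T) = rights T := rfl

@[simp] theorem rights_cons_inr (b : β) (T : List (α ⊕ β)) :
    rights (Sum.inr b :: T) = b :: rights T := rfl

@[simp] theorem lefts_append (S T : List (α ⊕ β)) : lefts (S ++ T) = lefts S ++ lefts T :=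
  List.filterMap_append

@[simp] theorem rights_append (S T : List (α ⊕ β)) : rights (S ++ T) = rights S ++ rights T :=
  List.filterMap_append

theorem mem_lefts {a : α} {T : List (α ⊕ β)} : a ∈ lefts T ↔ Sum.inl a ∈ T := by
  simp [lefts]

theorem mem_rights {b : β} {T : List (α ⊕ β)} : b ∈ rights T ↔ Sum.inr b ∈ T := by
  simp [rights]

theorem length_lefts_add_length_rights (T : List (α ⊕ β)) :
    (lefts T).length + (rights T).length = T.length := by
  induction T with
  | nil => rfl
  | cons s T ih => cases s <;> simp <;> omega

theorem length_lefts (T : List (α ⊕ β)) : (lefts T).length = T.countP Sum.isLeft := by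
  induction T with
  | nil => rfl
  | cons s T ih => cases s <;> simp [List.countP_cons, ih]

end LeftsRights

theorem forall_isSumArc_iff {k n : ℕ} {T : List ((ℕ × ℕ) ⊕ (ℕ × ℕ))} :
    (∀ s ∈ T, IsSumArc k n s) ↔ (∀ e ∈ lefts T, IsArc k e) ∧ ∀ e ∈ rights T, IsArc n e := by
  simp only [mem_lefts, mem_rights, Sum.forall, IsSumArc, Sum.elim_inl, Sum.elim_inr]

theorem gap_strictMono (c k : ℕ) : StrictMono (gap c k) := by
  intro x y h
  unfold gap
  split_ifs <;> omega

theorem gap_notMem_Icc (c k x : ℕ) : gap c k x ∉ Set.Icc c (c + k) := by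
  rw [Set.mem_Icc]
  unfold gap
  split_ifs <;> omega

theorem exists_gap_eq {c k x : ℕ} (hx : x ∉ Set.Icc c (c + k)) : ∃ y, gap c k y = x := by
  rw [Set.mem_Icc] at hx
  by_cases h : x < c
  · exact ⟨x, if_pos h⟩
  · exact ⟨x - (k + 1), by unfold gap; split_ifs <;> omega⟩

theorem gap_le_iff {c k n x : ℕ} (hc : c ≤ n + 1) : gap c k x ≤ n + (k + 1) ↔ x ≤ n := by
  unfold gap
  split_ifs <;> omega

theorem gap_of_le {c k x : ℕ} (h : c ≤ x) : gap c k x = x + (k + 1) :=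
  if_neg (Nat.not_lt.2 h)

theorem isArc_place {c k n : ℕ} (hc : c ≤ n + 1) {s : (ℕ × ℕ) ⊕ (ℕ × ℕ)} (hs : IsSumArc k n s) :
    IsArc (n + (k + 1)) (place c k s) := by
  rcases s with e | e <;> obtain ⟨h₁, h₂⟩ := hs
  · exact ⟨Nat.add_lt_add_right h₁ c, show e.2 + c ≤ _ by omega⟩
  · exact ⟨gap_strictMono c k h₁, (gap_le_iff hc).2 h₂⟩

theorem place_mem_Icc_iff {p : ℕ × ℕ → ℕ} (hp : IsEndpoint p) {c k n : ℕ}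
    {s : (ℕ × ℕ) ⊕ (ℕ × ℕ)} (hs : IsSumArc k n s) :
    p (place c k s) ∈ Set.Icc c (c + k) ↔ s.isLeft := by
  rcases s with e | e
  · have hle : p e ≤ k := (hp.le hs).trans hs.2
    simp only [place, Sum.elim_inl, hp.map, Set.mem_Icc, Sum.isLeft_inl, iff_true]
    omega
  · simp only [place, Sum.elim_inr, hp.map, gap_notMem_Icc, Sum.isLeft_inr, Bool.false_eq_true]

theorem place_injOn (c k n : ℕ) : Set.InjOn (place c k) {s | IsSumArc k n s} := by
  intro s hs s' hs' h
  have hiff : s.isLeft ↔ s'.isLeft := by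
    rw [← place_mem_Icc_iff (c := c) .fst hs, h, place_mem_Icc_iff .fst hs']
  rcases s with e | e <;> rcases s' with e' | e'
  · exact congrArg _ ((add_left_injective c).prodMap (add_left_injective c) h)
  · simp at hiff
  · simp at hiff
  · exact congrArg _ ((gap_strictMono c k).injective.prodMap (gap_strictMono c k).injective h)

theorem exists_place_eq {c k n : ℕ} (hc : c ≤ n + 1) {e : ℕ × ℕ} (he : IsArc (n + (k + 1)) e)
    (hcross : e.1 ∈ Set.Icc c (c + k) ↔ e.2 ∈ Set.Icc c (c + k)) :
    ∃ s, IsSumArc k n s ∧ place c k s = e := by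
  obtain ⟨a, b⟩ := e
  obtain ⟨h₁, h₂⟩ := he
  by_cases ha : a ∈ Set.Icc c (c + k)
  · have hb := hcross.1 ha
    rw [Set.mem_Icc] at ha hb
    exact ⟨Sum.inl (a - c, b - c), ⟨by simp only at h₁ ⊢; omega, by simp only at *; omega⟩,
      Prod.ext (Nat.sub_add_cancel ha.1) (Nat.sub_add_cancel hb.1)⟩
  · obtain ⟨a, rfl⟩ := exists_gap_eq ha
    obtain ⟨b, rfl⟩ := exists_gap_eq (mt hcross.2 ha)
    exact ⟨Sum.inr (a, b), ⟨(gap_strictMono c k).lt_iff_lt.1 h₁, (gap_le_iff hc).1 h₂⟩, rfl⟩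

theorem list_map_injOn {α β : Type*} {f : α → β} {p : α → Prop} (hf : Set.InjOn f {x | p x}) :
    Set.InjOn (List.map f) {l | ∀ x ∈ l, p x} := by
  intro l hl l' hl' h
  induction l generalizing l' with
  | nil => exact (List.map_eq_nil_iff.1 h.symm).symm
  | cons a l ih =>
    obtain ⟨b, l', rfl, hb, htail⟩ := List.map_eq_cons_iff.1 h.symm
    obtain ⟨ha, hl⟩ := List.forall_mem_cons.1 hl
    obtain ⟨hb', hl'⟩ := List.forall_mem_cons.1 hl'
    rw [hf ha hb' hb.symm, ih hl hl' htail.symm]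

theorem exists_map_place_eq {c k n : ℕ} (hc : c ≤ n + 1) {L : List (ℕ × ℕ)}
    (hL : ∀ e ∈ L, IsArc (n + (k + 1)) e)
    (hcross : ∀ e ∈ L, e.1 ∈ Set.Icc c (c + k) ↔ e.2 ∈ Set.Icc c (c + k)) :
    ∃ T : List _, (∀ s ∈ T, IsSumArc k n s) ∧ T.map (place c k) = L := by
  have hex : ∀ e ∈ L, ∃ s, IsSumArc k n s ∧ place c k s = e := fun e he =>
    exists_place_eq hc (hL e he) (hcross e he)
  choose! g hg hplace using hex
  refine ⟨L.map g, List.forall_mem_map.2 hg, ?_⟩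
  rw [List.map_map]
  exact (List.map_congr_left hplace).trans L.map_id

theorem arcProd_map_place_add {c k n : ℕ} {T : List ((ℕ × ℕ) ⊕ (ℕ × ℕ))}
    (hT : ∀ s ∈ T, IsSumArc k n s) {x : ℕ} (hx : x ≤ k) :
    arcProd (T.map (place c k)) (x + c) = arcProd (lefts T) x + c := by
  induction T generalizing x with
  | nil => rfl
  | cons s T ih =>
    obtain ⟨hs, hT'⟩ := List.forall_mem_cons.1 hT
    rw [List.map_cons, arcProd_cons, Equiv.Perm.mul_apply]
    rcases s with e | e
    · have hswap : Equiv.swap (e.1 + c) (e.2 + c) (x + c) = Equiv.swap e.1 e.2 x + c :=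
        (add_left_injective c).swap_apply _ _ _
      have hle : Equiv.swap e.1 e.2 x ≤ k :=
        arcProd_le (L := [e]) (List.forall_mem_singleton.2 hs) hx
      rw [lefts_cons_inl, arcProd_cons, Equiv.Perm.mul_apply, ← ih hT' hle, ← hswap]
      rfl
    · have hmem : x + c ∈ Set.Icc c (c + k) := ⟨by omega, by omega⟩
      rw [lefts_cons_inr, ← ih hT' hx, Equiv.swap_apply_of_ne_of_ne] <;>
        exact fun h => gap_notMem_Icc c k _ (h ▸ hmem)

theorem arcProd_map_place_gap {c k n : ℕ} {T : List ((ℕ × ℕ) ⊕ (ℕ × ℕ))}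
    (hT : ∀ s ∈ T, IsSumArc k n s) (x : ℕ) :
    arcProd (T.map (place c k)) (gap c k x) = gap c k (arcProd (rights T) x) := by
  induction T generalizing x with
  | nil => rfl
  | cons s T ih =>
    obtain ⟨hs, hT'⟩ := List.forall_mem_cons.1 hT
    rw [List.map_cons, arcProd_cons, Equiv.Perm.mul_apply]
    rcases s with e | e
    · rw [rights_cons_inl, ← ih hT', Equiv.swap_apply_of_ne_of_ne]
      · exact fun h => gap_notMem_Icc c k x (h ▸ (place_mem_Icc_iff .fst hs).2 rfl)
      · exact fun h => gap_notMem_Icc c k x (h ▸ (place_mem_Icc_iff .snd hs).2 rfl)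
    · rw [rights_cons_inr, arcProd_cons, Equiv.Perm.mul_apply, ← ih hT',
        ← (gap_strictMono c k).injective.swap_apply]
      rfl

/-! ### Cutting along the first arc -/

theorem cycle_swap_add {k n u y : ℕ} (hu : u ≤ n) (hy : y ≤ k) :
    cycle (n + (k + 1)) (Equiv.swap u (u + (k + 1)) (y + (u + 1))) = cycle k y + (u + 1) := by
  simp only [cycle_apply, Equiv.swap_apply_def]
  split_ifs <;> omega

theorem cycle_swap_gap {k n u : ℕ} (hu : u ≤ n) (y : ℕ) :
    cycle (n + (k + 1)) (Equiv.swap u (u + (k + 1)) (gap (u + 1) k y)) =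
      gap (u + 1) k (cycle n y) := by
  simp only [cycle_apply, Equiv.swap_apply_def, gap]
  split_ifs <;> omega

theorem arcProd_cons_eq_iff {e : ℕ × ℕ} {L : List (ℕ × ℕ)} {σ : Equiv.Perm ℕ} :
    arcProd (e :: L) = σ ↔ arcProd L = σ * Equiv.swap e.1 e.2 := by
  rw [arcProd_cons, ← eq_mul_inv_iff_mul_eq, Equiv.swap_inv]

theorem IsArc.exists_eq_add {N u v : ℕ} (h : IsArc N (u, v)) :
    ∃ k n, u ≤ n ∧ v = u + (k + 1) ∧ N = n + (k + 1) := by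
  obtain ⟨h₁, h₂⟩ := h
  simp only at h₁ h₂
  exact ⟨v - u - 1, N - (v - u), by omega, by omega, by omega⟩

theorem arcProd_cut_eq_cycle_iff {k n u : ℕ} (hu : u ≤ n) {T : List ((ℕ × ℕ) ⊕ (ℕ × ℕ))}
    (hT : ∀ s ∈ T, IsSumArc k n s) :
    arcProd ((u, u + (k + 1)) :: T.map (place (u + 1) k)) = cycle (n + (k + 1)) ↔
      arcProd (lefts T) = cycle k ∧ arcProd (rights T) = cycle n := by
  rw [arcProd_cons_eq_iff]
  constructor
  · refine fun h => ⟨Equiv.ext fun y => ?_, Equiv.ext fun y => ?_⟩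
    · rcases le_or_gt y k with hy | hy
      · have := DFunLike.congr_fun h (y + (u + 1))
        rw [arcProd_map_place_add hT hy, Equiv.Perm.mul_apply, cycle_swap_add hu hy] at this
        exact Nat.add_right_cancel this
      · rw [arcProd_of_lt (forall_isSumArc_iff.1 hT).1 hy, cycle_apply, if_neg hy.not_gt,
          if_neg hy.ne']
    · have := DFunLike.congr_fun h (gap (u + 1) k y)
      rw [arcProd_map_place_gap hT, Equiv.Perm.mul_apply, cycle_swap_gap hu] at this
      exact (gap_strictMono _ k).injective this
  · rintro ⟨hl, hr⟩
    refine Equiv.ext fun x => ?_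
    rw [Equiv.Perm.mul_apply]
    by_cases hx : x ∈ Set.Icc (u + 1) (u + 1 + k)
    · rw [Set.mem_Icc] at hx
      obtain ⟨y, rfl⟩ := Nat.exists_eq_add_of_le' hx.1
      have hy : y ≤ k := by omega
      rw [arcProd_map_place_add hT hy, hl, cycle_swap_add hu hy]
    · obtain ⟨y, rfl⟩ := exists_gap_eq hx
      rw [arcProd_map_place_gap hT, hr, cycle_swap_gap hu]

theorem isMinFactorization_cut_iff {k n u : ℕ} (hu : u ≤ n) {T : List ((ℕ × ℕ) ⊕ (ℕ × ℕ))}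
    (hT : ∀ s ∈ T, IsSumArc k n s) :
    IsMinFactorization (n + (k + 1)) ((u, u + (k + 1)) :: T.map (place (u + 1) k)) ↔
      IsMinFactorization k (lefts T) ∧ IsMinFactorization n (rights T) := by
  have hprod := arcProd_cut_eq_cycle_iff hu hT
  have hadd := length_lefts_add_length_rights T
  obtain ⟨hTl, hTr⟩ := forall_isSumArc_iff.1 hT
  constructor
  · rintro ⟨hlen, -, h⟩
    obtain ⟨hl, hr⟩ := hprod.1 h
    have := le_length_of_arcProd_eq_cycle hl
    have := le_length_of_arcProd_eq_cycle hr
    rw [List.length_cons, List.length_map] at hlen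
    exact ⟨⟨by omega, hTl, hl⟩, ⟨by omega, hTr, hr⟩⟩
  · rintro ⟨hl, hr⟩
    refine ⟨?_, List.forall_mem_cons.2 ⟨⟨by simp, by simpa⟩, List.forall_mem_map.2 fun s hs =>
      isArc_place (by omega) (hT s hs)⟩, hprod.2 ⟨hl.prod_eq, hr.prod_eq⟩⟩
    rw [List.length_cons, List.length_map, ← hadd, hl.length_eq, hr.length_eq]
    omega

theorem eq_of_mem_Icc_of_cut {k n u : ℕ} (hu : u ≤ n) {L : List (ℕ × ℕ)} {α : Type*} {ρ : ℕ → α}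
    (hL : arcProd ((u, u + (k + 1)) :: L) = cycle (n + (k + 1))) (hρ : ∀ e ∈ L, ρ e.1 = ρ e.2)
    {x : ℕ} (hx : x ∈ Set.Icc (u + 1) (u + 1 + k)) : ρ x = ρ (u + 1) := by
  rw [Set.mem_Icc] at hx
  obtain ⟨y, rfl⟩ := Nat.exists_eq_add_of_le' hx.1
  have hstep : ∀ y ≤ k, ρ (cycle k y + (u + 1)) = ρ (y + (u + 1)) := fun y hy => by
    rw [← apply_arcProd hρ (y + _), arcProd_cons_eq_iff.1 hL, Equiv.Perm.mul_apply,
      cycle_swap_add hu hy]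
  have hy : y ≤ k := by omega
  simpa using eq_of_apply_cycle (f := fun y => ρ (y + (u + 1))) hstep hy

theorem eq_of_notMem_Icc_of_cut {k n u : ℕ} (hu : u ≤ n) {L : List (ℕ × ℕ)} {α : Type*}
    {ρ : ℕ → α} (hL : arcProd ((u, u + (k + 1)) :: L) = cycle (n + (k + 1)))
    (hρ : ∀ e ∈ L, ρ e.1 = ρ e.2) {x : ℕ} (hle : x ≤ n + (k + 1))
    (hx : x ∉ Set.Icc (u + 1) (u + 1 + k)) : ρ x = ρ 0 := by
  obtain ⟨y, rfl⟩ := exists_gap_eq hx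
  have hstep : ∀ y ≤ n, ρ (gap (u + 1) k (cycle n y)) = ρ (gap (u + 1) k y) := fun y _ => by
    rw [← apply_arcProd hρ (gap _ _ y), arcProd_cons_eq_iff.1 hL, Equiv.Perm.mul_apply,
      cycle_swap_gap hu]
  have hy : y ≤ n := (gap_le_iff (by omega)).1 hle
  simpa [gap] using eq_of_apply_cycle (f := fun y => ρ (gap (u + 1) k y)) hstep hy

theorem IsMinFactorization.mem_Icc_iff_mem_Icc {k n u : ℕ} (hu : u ≤ n) {L : List (ℕ × ℕ)}
    (h : IsMinFactorization (n + (k + 1)) ((u, u + (k + 1)) :: L)) {e : ℕ × ℕ} (he : e ∈ L) :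
    e.1 ∈ Set.Icc (u + 1) (u + 1 + k) ↔ e.2 ∈ Set.Icc (u + 1) (u + 1 + k) := by
  obtain ⟨ρ, hρ, hcard⟩ := exists_classes_of_arcs L (Finset.range (n + (k + 1) + 1))
  have hblock {x} := eq_of_mem_Icc_of_cut hu h.prod_eq hρ (x := x)
  have hcompl {x} := eq_of_notMem_Icc_of_cut hu h.prod_eq hρ (x := x)
  -- A crossing arc would join the two classes, but `L` is too short to connect everything.
  have hne : ρ (u + 1) ≠ ρ 0 := fun heq => by
    have hone := card_image_le_one_of_const (n := n + (k + 1)) (ρ := ρ) fun x hx => by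
      by_cases hxI : x ∈ Set.Icc (u + 1) (u + 1 + k)
      · rw [hblock hxI, heq]
      · exact hcompl hx hxI
    have hlen := h.length_eq
    rw [Finset.card_range] at hcard
    rw [List.length_cons] at hlen
    omega
  obtain ⟨h₁, h₂⟩ := h.isArc e (List.mem_cons_of_mem _ he)
  constructor
  · exact fun ha => by_contra fun hb => hne (by rw [← hblock ha, hρ e he, hcompl h₂ hb])
  · exact fun hb => by_contra fun ha =>
      hne (by rw [← hblock hb, ← hρ e he, hcompl (h₁.le.trans h₂) ha])

theorem IsMinFactorization.exists_cut {k n u : ℕ} (hu : u ≤ n) {L : List (ℕ × ℕ)}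
    (h : IsMinFactorization (n + (k + 1)) ((u, u + (k + 1)) :: L)) :
    ∃ T : List _, (∀ s ∈ T, IsSumArc k n s) ∧ T.map (place (u + 1) k) = L :=
  exists_map_place_eq (by omega) (List.forall_mem_cons.1 h.isArc).2 fun _ =>
    h.mem_Icc_iff_mem_Icc hu

/-! ### The trajectory of the largest point -/

/-- The point to which the first `p` transpositions of a factorization of `(0 1 ⋯ n)` move `n`. -/
def trajectory (n : ℕ) (L : List (ℕ × ℕ)) (p : ℕ) : ℕ := arcProd (L.take p) n

theorem trajectory_append {n : ℕ} (A B : List (ℕ × ℕ)) :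
    trajectory n (A ++ B) A.length = arcProd A n := by
  rw [trajectory, List.take_left]

theorem trajectory_append_cons {n : ℕ} (A : List (ℕ × ℕ)) (e : ℕ × ℕ) (B : List (ℕ × ℕ)) :
    trajectory n (A ++ e :: B) (A.length + 1) = Equiv.swap e.1 e.2 (arcProd A n) := by
  simp [trajectory, List.take_append, List.take_of_length_le]

theorem trajectory_zero (n : ℕ) (L : List (ℕ × ℕ)) : trajectory n L 0 = n := rfl

theorem IsMinFactorization.trajectory_self {n : ℕ} {L : List (ℕ × ℕ)}
    (h : IsMinFactorization n L) : trajectory n L n = 0 := by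
  rw [trajectory, List.take_of_length_le h.length_eq.le, h.prod_eq, cycle_apply]
  simp

theorem IsMinFactorization.insert {n : ℕ} {A B : List (ℕ × ℕ)}
    (h : IsMinFactorization n (A ++ B)) :
    IsMinFactorization (n + 1) (A ++ (arcProd A n, n + 1) :: B) := by
  obtain ⟨hlen, harc, hprod⟩ := h
  obtain ⟨hA, hB⟩ := List.forall_mem_append.1 harc
  have hle : arcProd A n ≤ n := arcProd_le hA le_rfl
  refine ⟨by rw [List.length_append] at hlen ⊢; rw [List.length_cons]; omega,
    fun e he => ?_, ?_⟩
  · rw [List.mem_append, List.mem_cons] at he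
    rcases he with he | rfl | he
    · exact ⟨(hA e he).1, (hA e he).2.trans n.le_succ⟩
    · exact ⟨Nat.lt_succ_of_le hle, le_rfl⟩
    · exact ⟨(hB e he).1, (hB e he).2.trans n.le_succ⟩
  · have hswap : Equiv.swap (arcProd A n) (n + 1) * arcProd A =
        arcProd A * Equiv.swap n (n + 1) := by
      rw [Equiv.mul_swap_eq_swap_mul, arcProd_of_lt hA n.lt_succ_self]
    rw [arcProd_append] at hprod
    rw [arcProd_append, arcProd_cons, mul_assoc, hswap, ← mul_assoc, hprod]
    ext x
    simp only [Equiv.Perm.mul_apply, cycle_apply, Equiv.swap_apply_def]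
    split_ifs <;> omega

-- Joining `n + 1` to the current position of `n` produces a factorization in which the arcs after
-- the new one see it first, and the arcs before it see it first once they are rotated to the end.
theorem IsMinFactorization.insert_rotate {n : ℕ} {A B : List (ℕ × ℕ)}
    (h : IsMinFactorization n (A ++ B)) :
    IsMinFactorization (n + 1)
      ((arcProd A n, n + 1) :: (B ++ A.map (Prod.map (· + 1) (· + 1)))) := by
  have hA := (List.forall_mem_append.1 h.isArc).1
  have hrot := (isMinFactorization_append_iff_rotate
    (List.forall_mem_append.1 h.insert.isArc).1).1 h.insert
  have hmap : A.map (rotateArc (n + 1)) = A.map (Prod.map (· + 1) (· + 1)) :=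
    List.map_congr_left fun e he => if_pos (Nat.lt_succ_of_le (hA e he).2)
  rwa [hmap] at hrot

theorem IsMinFactorization.countP_mem_Icc {p : ℕ × ℕ → ℕ} (hp : IsEndpoint p) {k n u : ℕ}
    (hu : u ≤ n) {L : List (ℕ × ℕ)} (h : IsMinFactorization (n + (k + 1)) ((u, u + (k + 1)) :: L)) :
    L.countP (fun e => p e ∈ Set.Icc (u + 1) (u + 1 + k)) = k := by
  obtain ⟨T, hT, rfl⟩ := h.exists_cut hu
  refine Eq.trans ?_ ((isMinFactorization_cut_iff hu hT).1 h).1.length_eq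
  rw [List.countP_map, length_lefts]
  refine List.countP_congr fun s hs => ?_
  simpa only [Function.comp_apply, decide_eq_true_eq] using place_mem_Icc_iff hp (hT s hs)

theorem IsMinFactorization.countP_add_countP {p : ℕ × ℕ → ℕ} (hp : IsEndpoint p) {n : ℕ}
    {A B : List (ℕ × ℕ)} (h : IsMinFactorization n (A ++ B)) :
    A.countP (fun e => arcProd A n ≤ p e) + B.countP (fun e => arcProd A n + 1 ≤ p e) +
      arcProd A n = n := by
  obtain ⟨hA, hB⟩ := List.forall_mem_append.1 h.isArc
  have hle : arcProd A n ≤ n := arcProd_le hA le_rfl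
  have hins := h.insert_rotate
  generalize arcProd A n = x at *
  obtain ⟨k, rfl⟩ := Nat.exists_eq_add_of_le hle
  have hcount := hins.countP_mem_Icc hp (k := k) le_rfl
  rw [List.countP_append, List.countP_map] at hcount
  have hcountA : A.countP (fun e => x ≤ p e) =
      A.countP ((fun e => p e ∈ Set.Icc (x + 1) (x + 1 + k)) ∘ Prod.map (· + 1) (· + 1)) :=
    List.countP_congr fun e he => by
      have := (hp.le (hA e he)).trans (hA e he).2
      simp only [Function.comp_apply, hp.map, Set.mem_Icc, decide_eq_true_eq]
      omega
  have hcountB : B.countP (fun e => x + 1 ≤ p e) =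
      B.countP (fun e => p e ∈ Set.Icc (x + 1) (x + 1 + k)) :=
    List.countP_congr fun e he => by
      have := (hp.le (hB e he)).trans (hB e he).2
      simp only [Set.mem_Icc, decide_eq_true_eq]
      omega
  omega

theorem IsMinFactorization.arcProd_apply_ne_fst {n : ℕ} {A B : List (ℕ × ℕ)} {e : ℕ × ℕ}
    (h : IsMinFactorization n (A ++ e :: B)) : arcProd A n ≠ e.1 := by
  intro heq
  obtain ⟨hA, he⟩ := List.forall_mem_append.1 h.isArc
  obtain ⟨h₁, h₂⟩ := (List.forall_mem_cons.1 he).1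
  have hle : arcProd A n ≤ n := arcProd_le hA le_rfl
  have hins := h.insert_rotate
  rw [heq] at hle hins
  obtain ⟨k, hk⟩ := Nat.exists_eq_add_of_le hle
  rw [hk] at hins
  have hiff := hins.mem_Icc_iff_mem_Icc (k := k) le_rfl (e := e) (by simp)
  simp only [Set.mem_Icc] at hiff
  omega

theorem IsMinFactorization.exists_of_trajectory_ne {n p : ℕ} {L : List (ℕ × ℕ)}
    (h : IsMinFactorization n L) (hp : p < n)
    (hne : trajectory n L (p + 1) ≠ trajectory n L p) :
    ∃ A e B, L = A ++ e :: B ∧ A.length = p ∧ arcProd A n = e.2 := by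
  have hpL : p < L.length := h.length_eq.symm ▸ hp
  have hL : L = L.take p ++ L[p] :: L.drop (p + 1) := by simp
  have hlen : (L.take p).length = p := List.length_take_of_le hpL.le
  generalize L.take p = A at *
  generalize L[p] = e at *
  generalize L.drop (p + 1) = B at *
  subst hL hlen
  refine ⟨A, e, B, rfl, rfl, ?_⟩
  rw [trajectory_append, trajectory_append_cons] at hne
  by_contra hsnd
  exact hne (Equiv.swap_apply_of_ne_of_ne h.arcProd_apply_ne_fst hsnd)

/-! ### Gluing two factorizations -/

section LeftsRights

variable {α β γ δ : Type*} (f : α → γ) (g : β → δ)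

theorem lefts_map_sumMap (T : List (α ⊕ β)) : lefts (T.map (Sum.map f g)) = (lefts T).map f := by
  induction T with
  | nil => rfl
  | cons s T ih => cases s <;> simp [ih]

theorem rights_map_sumMap (T : List (α ⊕ β)) :
    rights (T.map (Sum.map f g)) = (rights T).map g := by
  induction T with
  | nil => rfl
  | cons s T ih => cases s <;> simp [ih]

end LeftsRights

/-- The factorization of `(0 1 ⋯ n + k + 1)` with the arc `(u, u + k + 1)`, whose left arcs act on
the block `{u, …, u + k}` before that arc and on `{u + 1, …, u + k + 1}` after it. -/
def assemble (u k : ℕ) (T₁ T₂ : List ((ℕ × ℕ) ⊕ (ℕ × ℕ))) : List (ℕ × ℕ) :=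
  T₁.map (place u k) ++ (u, u + (k + 1)) :: T₂.map (place (u + 1) k)

theorem rotateArc_place {k n u : ℕ} (hu : u ≤ n) {s : (ℕ × ℕ) ⊕ (ℕ × ℕ)} (hs : IsSumArc k n s) :
    rotateArc (n + (k + 1)) (place u k s) = place (u + 1) k (Sum.map id (rotateArc n) s) := by
  rcases s with ⟨a, b⟩ | ⟨a, b⟩ <;> obtain ⟨h₁, h₂⟩ := hs <;> simp only at h₁ h₂
  · exact if_pos (show b + u < n + (k + 1) by omega)
  · rcases h₂.lt_or_eq with hb | rfl
    · have hgap : gap u k b < n + (k + 1) := by unfold gap; split_ifs <;> omega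
      rw [Sum.map_inr, show rotateArc n (a, b) = (a + 1, b + 1) from if_pos hb]
      refine (if_pos hgap).trans (Prod.ext ?_ ?_) <;>
        simp only [place, gap, Sum.elim_inr, Prod.map] <;> split_ifs <;> omega
    · have hgap : ¬ gap u k b < b + (k + 1) := by unfold gap; split_ifs <;> omega
      rw [Sum.map_inr, show rotateArc b (a, b) = (0, a + 1) from if_neg (lt_irrefl b)]
      refine (if_neg hgap).trans (Prod.ext ?_ ?_) <;>
        simp only [place, gap, Sum.elim_inr, Prod.map] <;> split_ifs <;> omega

theorem isMinFactorization_assemble_iff {k n u : ℕ} (hu : u ≤ n)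
    {T₁ T₂ : List ((ℕ × ℕ) ⊕ (ℕ × ℕ))} (h₁ : ∀ s ∈ T₁, IsSumArc k n s)
    (h₂ : ∀ s ∈ T₂, IsSumArc k n s) :
    IsMinFactorization (n + (k + 1)) (assemble u k T₁ T₂) ↔
      IsMinFactorization k (lefts T₂ ++ lefts T₁) ∧
        IsMinFactorization n (rights T₁ ++ rights T₂) := by
  have hrot : (T₁.map (place u k)).map (rotateArc (n + (k + 1))) =
      (T₁.map (Sum.map id (rotateArc n))).map (place (u + 1) k) := by
    rw [List.map_map, List.map_map]
    exact List.map_congr_left fun s hs => rotateArc_place hu (h₁ s hs)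
  have hsum : ∀ s ∈ T₂ ++ T₁.map (Sum.map id (rotateArc n)), IsSumArc k n s := by
    rw [List.forall_mem_append, List.forall_mem_map]
    refine ⟨h₂, fun s hs => ?_⟩
    rcases s with e | e
    exacts [h₁ _ hs, (h₁ _ hs).rotateArc]
  rw [assemble, isMinFactorization_append_iff_rotate
      (List.forall_mem_map.2 fun s hs => isArc_place (by omega) (h₁ s hs)), hrot, List.cons_append,
    ← List.map_append, isMinFactorization_cut_iff hu hsum, lefts_append, rights_append,
    lefts_map_sumMap, rights_map_sumMap, List.map_id,
    isMinFactorization_append_iff_rotate (forall_isSumArc_iff.1 h₁).2]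

theorem rotateArc_noncrossing_iff {c k n : ℕ} (hc : c ≤ n) {e : ℕ × ℕ}
    (he : IsArc (n + (k + 1)) e) :
    ((rotateArc (n + (k + 1)) e).1 ∈ Set.Icc (c + 1) (c + 1 + k) ↔
        (rotateArc (n + (k + 1)) e).2 ∈ Set.Icc (c + 1) (c + 1 + k)) ↔
      (e.1 ∈ Set.Icc c (c + k) ↔ e.2 ∈ Set.Icc c (c + k)) := by
  obtain ⟨h₁, h₂⟩ := he
  unfold rotateArc
  split_ifs <;> simp only [Set.mem_Icc] <;> omega

theorem IsMinFactorization.exists_assemble {k n u : ℕ} (hu : u ≤ n) {A B : List (ℕ × ℕ)}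
    (h : IsMinFactorization (n + (k + 1)) (A ++ (u, u + (k + 1)) :: B)) :
    ∃ T₁ T₂ : List _, (∀ s ∈ T₁, IsSumArc k n s) ∧ (∀ s ∈ T₂, IsSumArc k n s) ∧
      T₁.map (place u k) = A ∧ T₂.map (place (u + 1) k) = B := by
  obtain ⟨hA, hB⟩ := List.forall_mem_append.1 h.isArc
  have hrot := (isMinFactorization_append_iff_rotate hA).1 h
  obtain ⟨T₁, hT₁, h₁⟩ := exists_map_place_eq (c := u) (by omega) hA fun e he =>
    (rotateArc_noncrossing_iff hu (hA e he)).1 <| hrot.mem_Icc_iff_mem_Icc hu <|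
      List.mem_append_right _ (List.mem_map_of_mem he)
  obtain ⟨T₂, hT₂, h₂⟩ := exists_map_place_eq (c := u + 1) (by omega)
    (List.forall_mem_cons.1 hB).2 fun e he =>
      hrot.mem_Icc_iff_mem_Icc hu (List.mem_append_left _ he)
  exact ⟨T₁, T₂, hT₁, hT₂, h₁, h₂⟩

/-- A factorization of `(0 1 ⋯ k)` and one of `(0 1 ⋯ n)`, each cut in two, with the final part of
the first and the initial part of the second shuffled in `T₁`, and the remaining parts in `T₂`. -/
structure IsSplitting (k n : ℕ) (T₁ T₂ : List ((ℕ × ℕ) ⊕ (ℕ × ℕ))) : Prop where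
  left : IsMinFactorization k (lefts T₂ ++ lefts T₁)
  right : IsMinFactorization n (rights T₁ ++ rights T₂)

/-- The factorization assembled from a splitting at the one place where the new arc takes part in
the trajectory of the largest point. -/
def glue (k n : ℕ) (T₁ T₂ : List ((ℕ × ℕ) ⊕ (ℕ × ℕ))) : List (ℕ × ℕ) :=
  assemble (arcProd (rights T₁) n) k T₁ T₂

section Splitting

variable {k n : ℕ} {T₁ T₂ : List ((ℕ × ℕ) ⊕ (ℕ × ℕ))}

theorem IsSplitting.isSumArc_fst (h : IsSplitting k n T₁ T₂) : ∀ s ∈ T₁, IsSumArc k n s :=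
  forall_isSumArc_iff.2 ⟨(List.forall_mem_append.1 h.left.isArc).2,
    (List.forall_mem_append.1 h.right.isArc).1⟩

theorem IsSplitting.isSumArc_snd (h : IsSplitting k n T₁ T₂) : ∀ s ∈ T₂, IsSumArc k n s :=
  forall_isSumArc_iff.2 ⟨(List.forall_mem_append.1 h.left.isArc).1,
    (List.forall_mem_append.1 h.right.isArc).2⟩

theorem IsSplitting.arcProd_rights_le (h : IsSplitting k n T₁ T₂) : arcProd (rights T₁) n ≤ n :=
  arcProd_le (List.forall_mem_append.1 h.right.isArc).1 le_rfl

theorem IsSplitting.isMinFactorization_glue (h : IsSplitting k n T₁ T₂) :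
    IsMinFactorization (n + (k + 1)) (glue k n T₁ T₂) :=
  (isMinFactorization_assemble_iff h.arcProd_rights_le h.isSumArc_fst h.isSumArc_snd).2
    ⟨h.left, h.right⟩

theorem arcProd_map_place_last {u : ℕ} (hu : u ≤ n) (hT : ∀ s ∈ T₁, IsSumArc k n s) :
    arcProd (T₁.map (place u k)) (n + (k + 1)) = gap u k (arcProd (rights T₁) n) := by
  rw [← gap_of_le hu, arcProd_map_place_gap hT]

theorem IsSplitting.trajectory_glue (h : IsSplitting k n T₁ T₂) :
    trajectory (n + (k + 1)) (glue k n T₁ T₂) T₁.length = arcProd (rights T₁) n + (k + 1) := by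
  rw [glue, assemble, ← List.length_map (place (arcProd (rights T₁) n) k), trajectory_append,
    arcProd_map_place_last h.arcProd_rights_le h.isSumArc_fst, gap_of_le le_rfl]

theorem IsSplitting.trajectory_glue_succ (h : IsSplitting k n T₁ T₂) :
    trajectory (n + (k + 1)) (glue k n T₁ T₂) (T₁.length + 1) = arcProd (rights T₁) n := by
  rw [glue, assemble, ← List.length_map (place (arcProd (rights T₁) n) k), trajectory_append_cons,
    arcProd_map_place_last h.arcProd_rights_le h.isSumArc_fst, gap_of_le le_rfl,
    Equiv.swap_apply_right]

theorem IsSplitting.length_fst_lt (h : IsSplitting k n T₁ T₂) : T₁.length < n + (k + 1) := by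
  rw [← h.isMinFactorization_glue.length_eq]
  simp [glue, assemble]

theorem IsMinFactorization.exists_glue {N p : ℕ} {L : List (ℕ × ℕ)} (h : IsMinFactorization N L)
    (hp : p < N) (hne : trajectory N L (p + 1) ≠ trajectory N L p) :
    ∃ k n T₁ T₂, N = n + (k + 1) ∧ IsSplitting k n T₁ T₂ ∧ glue k n T₁ T₂ = L ∧
      T₁.length = p := by
  obtain ⟨A, ⟨u, v⟩, B, rfl, rfl, htraj⟩ := h.exists_of_trajectory_ne hp hne
  obtain ⟨k, n, hu, rfl, rfl⟩ := (h.isArc (u, v) (by simp)).exists_eq_add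
  obtain ⟨T₁, T₂, hT₁, hT₂, rfl, rfl⟩ := h.exists_assemble hu
  have hpos : arcProd (rights T₁) n = u := by
    rw [arcProd_map_place_last hu hT₁, ← gap_of_le le_rfl] at htraj
    exact (gap_strictMono u k).injective htraj
  obtain ⟨hl, hr⟩ := (isMinFactorization_assemble_iff hu hT₁ hT₂).1 h
  exact ⟨k, n, T₁, T₂, rfl, ⟨hl, hr⟩, by rw [glue, hpos]; rfl, List.length_map _ |>.symm⟩

theorem IsSplitting.glue_inj {k' n' : ℕ} {T₁' T₂' : List ((ℕ × ℕ) ⊕ (ℕ × ℕ))}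
    (h : IsSplitting k n T₁ T₂) (h' : IsSplitting k' n' T₁' T₂')
    (hsum : n + (k + 1) = n' + (k' + 1)) (hlen : T₁.length = T₁'.length)
    (hglue : glue k n T₁ T₂ = glue k' n' T₁' T₂') :
    k = k' ∧ n = n' ∧ T₁ = T₁' ∧ T₂ = T₂' := by
  obtain ⟨hA, hcons⟩ := List.append_inj hglue (by simpa using hlen)
  rw [List.cons.injEq, Prod.mk.injEq] at hcons
  obtain ⟨⟨hu, hv⟩, hB⟩ := hcons
  obtain rfl : k = k' := by omega
  obtain rfl : n = n' := by omega
  rw [← hu] at hA hB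
  exact ⟨rfl, rfl, list_map_injOn (place_injOn _ _ _) h.isSumArc_fst h'.isSumArc_fst hA,
    list_map_injOn (place_injOn _ _ _) h.isSumArc_snd h'.isSumArc_snd hB⟩

end Splitting

/-! ### Areas -/

/-- The lower area of a factorization of `(0 1 ⋯ n)` given by its arcs. -/
def lowerArea (n : ℕ) (L : List (ℕ × ℕ)) : ℤ := n.choose 2 - ((L.map Prod.fst).sum : ℕ)

/-- The upper area of a factorization of `(0 1 ⋯ n)` given by its arcs. -/
def upperArea (n : ℕ) (L : List (ℕ × ℕ)) : ℤ := ((L.map Prod.snd).sum : ℕ) - n.choose 2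

theorem choose_two_add_succ (n k : ℕ) :
    (n + (k + 1)).choose 2 = n.choose 2 + k.choose 2 + k + n * (k + 1) := by
  induction k with
  | zero => simp [Nat.choose_succ_succ', add_comm]
  | succ k ih =>
    rw [← add_assoc, Nat.choose_succ_succ' _ 1, ih, Nat.choose_one_right,
      Nat.choose_succ_succ' k 1, Nat.choose_one_right]
    ring

theorem sum_map_place {p : ℕ × ℕ → ℕ} (hp : IsEndpoint p) (c k : ℕ)
    (T : List ((ℕ × ℕ) ⊕ (ℕ × ℕ))) :
    ((T.map (place c k)).map p).sum =
      ((lefts T).map p).sum + (lefts T).length * c +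
        (((rights T).map p).sum + (k + 1) * (rights T).countP (fun e => c ≤ p e)) := by
  induction T with
  | nil => simp
  | cons s T ih =>
    rw [List.map_cons, List.map_cons, List.sum_cons, ih]
    rcases s with e | e
    · simp only [List.map_cons, List.sum_cons, place, Sum.elim_inl, hp.map, lefts_cons_inl,
        rights_cons_inl, List.length_cons]
      ring
    · simp only [List.map_cons, List.sum_cons, place, Sum.elim_inr, hp.map, lefts_cons_inr,
        rights_cons_inr, List.countP_cons, decide_eq_true_eq, gap]
      split_ifs
      · omega
      · ring
      · ring
      · omega

theorem IsSplitting.sum_map_glue {p : ℕ × ℕ → ℕ} (hp : IsEndpoint p) {k n : ℕ}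
    {T₁ T₂ : List ((ℕ × ℕ) ⊕ (ℕ × ℕ))} (h : IsSplitting k n T₁ T₂) :
    ((glue k n T₁ T₂).map p).sum + arcProd (rights T₁) n =
      ((lefts T₂ ++ lefts T₁).map p).sum + ((rights T₁ ++ rights T₂).map p).sum +
        (n * (k + 1) + (lefts T₂).length +
          p (arcProd (rights T₁) n, arcProd (rights T₁) n + (k + 1))) := by
  have hcount := h.right.countP_add_countP hp
  have hlen := h.left.length_eq
  rw [List.length_append] at hlen
  generalize hu : arcProd (rights T₁) n = u at *
  rw [glue, assemble, hu, List.map_append, List.map_cons, List.sum_append, List.sum_cons,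
    sum_map_place hp, sum_map_place hp, List.map_append, List.map_append, List.sum_append,
    List.sum_append]
  linear_combination u * hlen + (k + 1) * hcount

section Splitting

variable {k n : ℕ} {T₁ T₂ : List ((ℕ × ℕ) ⊕ (ℕ × ℕ))}

theorem IsSplitting.lowerArea_glue (h : IsSplitting k n T₁ T₂) :
    lowerArea (n + (k + 1)) (glue k n T₁ T₂) =
      lowerArea k (lefts T₂ ++ lefts T₁) + lowerArea n (rights T₁ ++ rights T₂) +
        (lefts T₁).length := by
  have hsum := h.sum_map_glue .fst
  have hlen := h.left.length_eq
  rw [List.length_append] at hlen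
  rw [lowerArea, lowerArea, lowerArea, choose_two_add_succ]
  zify at hsum hlen
  push_cast
  linear_combination -hsum - hlen

theorem IsSplitting.upperArea_glue (h : IsSplitting k n T₁ T₂) :
    upperArea (n + (k + 1)) (glue k n T₁ T₂) =
      upperArea k (lefts T₂ ++ lefts T₁) + upperArea n (rights T₁ ++ rights T₂) +
        ((lefts T₂).length + 1) := by
  have hsum := h.sum_map_glue .snd
  rw [upperArea, upperArea, upperArea, choose_two_add_succ]
  zify at hsum
  push_cast
  linear_combination hsum

end Splitting

theorem IsMinFactorization.exists_trajectory_ne {n : ℕ} {L : List (ℕ × ℕ)}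
    (h : IsMinFactorization n L) (hn : n ≠ 0) :
    ∃ p < n, trajectory n L (p + 1) ≠ trajectory n L p := by
  by_contra! hconst
  have hstay : ∀ p ≤ n, trajectory n L p = n := fun p hp => by
    induction p with
    | zero => exact trajectory_zero n L
    | succ p ih => rw [hconst p hp, ih (by omega)]
  exact hn ((hstay n le_rfl).symm.trans h.trajectory_self)

theorem IsMinFactorization.area_nonneg {n : ℕ} {L : List (ℕ × ℕ)} (h : IsMinFactorization n L) :
    0 ≤ lowerArea n L ∧ 0 ≤ upperArea n L := by
  induction n using Nat.strong_induction_on generalizing L with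
  | _ N ih =>
    rcases eq_or_ne N 0 with rfl | hN
    · obtain rfl := List.length_eq_zero_iff.1 h.length_eq
      exact ⟨le_rfl, le_rfl⟩
    · obtain ⟨p, hp, hne⟩ := h.exists_trajectory_ne hN
      obtain ⟨k, n, T₁, T₂, rfl, hT, rfl, -⟩ := h.exists_glue hp hne
      obtain ⟨hl, hu⟩ := ih k (by omega) hT.left
      obtain ⟨hl', hu'⟩ := ih n (by omega) hT.right
      rw [hT.lowerArea_glue, hT.upperArea_glue]
      omega

/-- The monomial `q ^ area_L * t ^ area_U` of a factorization given by its arcs. -/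
noncomputable def weight (n : ℕ) (L : List (ℕ × ℕ)) : Coeff :=
  q ^ (lowerArea n L).toNat * t ^ (upperArea n L).toNat

theorem IsSplitting.weight_glue {k n : ℕ} {T₁ T₂ : List ((ℕ × ℕ) ⊕ (ℕ × ℕ))}
    (h : IsSplitting k n T₁ T₂) :
    weight (n + (k + 1)) (glue k n T₁ T₂) =
      t * t ^ (lefts T₂).length * q ^ (lefts T₁).length *
        (weight k (lefts T₂ ++ lefts T₁) * weight n (rights T₁ ++ rights T₂)) := by
  obtain ⟨hl, hu⟩ := h.left.area_nonneg
  obtain ⟨hl', hu'⟩ := h.right.area_nonneg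
  have hlower := h.lowerArea_glue
  have hupper := h.upperArea_glue
  unfold weight
  lift lowerArea k (lefts T₂ ++ lefts T₁) to ℕ using hl with a
  lift lowerArea n (rights T₁ ++ rights T₂) to ℕ using hl' with b
  lift upperArea k (lefts T₂ ++ lefts T₁) to ℕ using hu with c
  lift upperArea n (rights T₁ ++ rights T₂) to ℕ using hu' with d
  rw [hlower, hupper]
  norm_cast
  ring

/-! ### Sequences of transpositions as lists of arcs -/

/-- The arc `(a, b)` of a transposition `(a b)` with `a < b`. -/
noncomputable def arc {n : ℕ} (π : Equiv.Perm (Fin (n + 1))) : ℕ × ℕ :=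
  (lower π, upper π)

/-- The list of the arcs of a sequence of transpositions. -/
noncomputable def arcs {n m : ℕ} (τ : Fin m → Equiv.Perm (Fin (n + 1))) : List (ℕ × ℕ) :=
  (List.ofFn τ).map arc

section Arc

variable {n : ℕ} {π : Equiv.Perm (Fin (n + 1))}

theorem exists_lt_of_isSwap (h : π.IsSwap) : ∃ a b, a < b ∧ π = Equiv.swap a b := by
  obtain ⟨a, b, hab, rfl⟩ := h
  rcases hab.lt_or_gt with h | h
  · exact ⟨a, b, h, rfl⟩
  · exact ⟨b, a, h, Equiv.swap_comm a b⟩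

theorem arc_swap {a b : Fin (n + 1)} (h : a < b) : arc (Equiv.swap a b) = (↑a, ↑b) := by
  rw [arc, lower_swap h, upper_swap h]

theorem isArc_arc (h : π.IsSwap) : IsArc n (arc π) := by
  obtain ⟨a, b, hab, rfl⟩ := exists_lt_of_isSwap h
  rw [arc_swap hab]
  exact ⟨hab, Nat.le_of_lt_succ b.2⟩

theorem IsArc.exists_arc_eq {e : ℕ × ℕ} (he : IsArc n e) :
    ∃ π : Equiv.Perm (Fin (n + 1)), π.IsSwap ∧ arc π = e := by
  obtain ⟨h₁, h₂⟩ := he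
  have hlt : (⟨e.1, by omega⟩ : Fin (n + 1)) < ⟨e.2, by omega⟩ := h₁
  exact ⟨_, ⟨_, _, hlt.ne, rfl⟩, arc_swap hlt⟩

theorem arc_injOn (n : ℕ) :
    Set.InjOn (arc : Equiv.Perm (Fin (n + 1)) → ℕ × ℕ) {π | π.IsSwap} := by
  intro π hπ σ hσ h
  obtain ⟨a, b, hab, rfl⟩ := exists_lt_of_isSwap hπ
  obtain ⟨c, d, hcd, rfl⟩ := exists_lt_of_isSwap hσ
  rw [arc_swap hab, arc_swap hcd, Prod.mk.injEq] at h
  rw [Fin.ext h.1, Fin.ext h.2]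

theorem swap_arc_apply (h : π.IsSwap) (x : Fin (n + 1)) :
    Equiv.swap (arc π).1 (arc π).2 x = π x := by
  obtain ⟨a, b, hab, rfl⟩ := exists_lt_of_isSwap h
  rw [arc_swap hab]
  exact Fin.val_injective.swap_apply a b x

theorem arcProd_map_arc_apply {l : List (Equiv.Perm (Fin (n + 1)))} (hl : ∀ π ∈ l, π.IsSwap)
    (x : Fin (n + 1)) : arcProd (l.map arc) x = l.reverse.prod x := by
  induction l generalizing x with
  | nil => rfl
  | cons π l ih =>
    obtain ⟨hπ, hl⟩ := List.forall_mem_cons.1 hl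
    rw [List.map_cons, arcProd_cons, Equiv.Perm.mul_apply, swap_arc_apply hπ, ih hl]
    simp

end Arc

theorem canonicalCycle_apply (n : ℕ) (x : Fin (n + 1)) :
    (canonicalCycle n x : ℕ) = cycle n x := by
  rw [canonicalCycle, cycle_apply]
  split_ifs with hlt heq
  · rw [finRotate_of_lt hlt]
  · rw [show x = Fin.last n from Fin.ext heq, finRotate_last]
    rfl
  · omega

section Arcs

variable {n : ℕ} {τ : Fin n → Equiv.Perm (Fin (n + 1))}

theorem isMinFactorization_arcs_iff (hτ : ∀ i, (τ i).IsSwap) :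
    IsMinFactorization n (arcs τ) ↔ leftToRightProd τ = canonicalCycle n := by
  have hl : ∀ π ∈ List.ofFn τ, π.IsSwap := List.forall_mem_ofFn_iff.2 hτ
  have harc : ∀ e ∈ arcs τ, IsArc n e := List.forall_mem_map.2 fun π hπ => isArc_arc (hl π hπ)
  constructor
  · intro h
    ext x
    rw [canonicalCycle_apply, ← h.prod_eq, arcs, arcProd_map_arc_apply hl, leftToRightProd]
  · refine fun h => ⟨by simp [arcs], harc, Equiv.ext fun x => ?_⟩
    rcases le_or_gt x n with hx | hx
    · have happly := arcProd_map_arc_apply hl ⟨x, Nat.lt_succ_of_le hx⟩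
      rwa [← leftToRightProd, h, canonicalCycle_apply] at happly
    · rw [arcProd_of_lt harc hx, cycle_apply, if_neg (by omega), if_neg (by omega)]

theorem mem_minimalFactorizations :
    τ ∈ minimalFactorizations n ↔ (∀ i, (τ i).IsSwap) ∧ IsMinFactorization n (arcs τ) := by
  simp only [minimalFactorizations, Finset.mem_filter, Finset.mem_univ, true_and]
  exact and_congr_right fun h => (isMinFactorization_arcs_iff h).symm

theorem IsMinFactorization.exists_arcs_eq {L : List (ℕ × ℕ)} (h : IsMinFactorization n L) :
    ∃ τ ∈ minimalFactorizations n, arcs τ = L := by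
  obtain rfl := h.length_eq
  choose τ hτ harc using fun i : Fin L.length => (h.isArc _ (L.get_mem i)).exists_arc_eq
  have harcs : arcs τ = L := by
    rw [arcs, List.map_ofFn, show arc ∘ τ = L.get from funext harc, List.ofFn_get]
  exact ⟨τ, mem_minimalFactorizations.2 ⟨hτ, by rwa [harcs]⟩, harcs⟩

theorem arcs_injOn (n : ℕ) :
    Set.InjOn (arcs : (Fin n → Equiv.Perm (Fin (n + 1))) → _) (minimalFactorizations n) := by
  intro τ hτ σ hσ h
  rw [arcs, arcs, List.map_ofFn, List.map_ofFn] at h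
  exact funext fun i => arc_injOn n ((mem_minimalFactorizations.1 hτ).1 i)
    ((mem_minimalFactorizations.1 hσ).1 i) (congrFun (List.ofFn_injective h) i)

theorem areaL_eq_lowerArea (τ : Fin n → Equiv.Perm (Fin (n + 1))) :
    areaL τ = lowerArea n (arcs τ) := by
  simp [areaL, lowerArea, arcs, arc, List.map_ofFn, List.sum_ofFn]

theorem areaU_eq_upperArea (τ : Fin n → Equiv.Perm (Fin (n + 1))) :
    areaU τ = upperArea n (arcs τ) := by
  simp [areaU, upperArea, arcs, arc, List.map_ofFn, List.sum_ofFn]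

end Arcs

/-- The minimal factorizations of `(0 1 ⋯ n)`, as lists of arcs. -/
noncomputable def arcFactorizations (n : ℕ) : Finset (List (ℕ × ℕ)) :=
  (minimalFactorizations n).image arcs

theorem mem_arcFactorizations {n : ℕ} {L : List (ℕ × ℕ)} :
    L ∈ arcFactorizations n ↔ IsMinFactorization n L := by
  rw [arcFactorizations, Finset.mem_image]
  constructor
  · rintro ⟨τ, hτ, rfl⟩
    exact (mem_minimalFactorizations.1 hτ).2
  · exact IsMinFactorization.exists_arcs_eq

theorem F_eq_sum_weight (n : ℕ) : F n = ∑ L ∈ arcFactorizations n, weight n L := by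
  rw [arcFactorizations, Finset.sum_image (arcs_injOn n), F]
  exact Finset.sum_congr rfl fun τ _ => by rw [weight, areaL_eq_lowerArea, areaU_eq_upperArea]

/-! ### Counting splittings -/

open Finset.HasAntidiagonal (antidiagonal mem_antidiagonal)

theorem sum_antidiagonal_choose_mul_choose (i j n : ℕ) :
    ∑ p ∈ antidiagonal n, (i + p.1).choose i * (j + p.2).choose j =
      (i + j + 1 + n).choose (i + j + 1) := by
  have h := congrArg (fun u => PowerSeries.coeff n (Units.val u))
    (PowerSeries.invOneSubPow_add (S := ℤ) (i + 1) (j + 1))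
  rw [show i + 1 + (j + 1) = i + j + 1 + 1 by ring] at h
  simp only [Units.val_mul, PowerSeries.invOneSubPow_val_succ_eq_mk_add_choose,
    PowerSeries.coeff_mul, PowerSeries.coeff_mk] at h
  exact_mod_cast h.symm

section Shuffles

variable {α β : Type*} [DecidableEq α] [DecidableEq β]

/-- The shuffles of two lists, each entry remembering which list it comes from. -/
def shuffles : List α → List β → Finset (List (α ⊕ β))
  | [], B => {B.map Sum.inr}
  | a :: A, [] => {(a :: A).map Sum.inl}
  | a :: A, b :: B =>
    (shuffles A (b :: B)).map ⟨_, List.cons_injective (a := Sum.inl a)⟩ ∪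
      (shuffles (a :: A) B).map ⟨_, List.cons_injective (a := Sum.inr b)⟩

theorem shuffles_nil_left (B : List β) : shuffles ([] : List α) B = {B.map Sum.inr} := by
  rw [shuffles]

theorem shuffles_nil_right (A : List α) : shuffles A ([] : List β) = {A.map Sum.inl} := by
  cases A <;> simp [shuffles]

theorem mem_shuffles {A : List α} {B : List β} {T : List (α ⊕ β)} :
    T ∈ shuffles A B ↔ lefts T = A ∧ rights T = B := by
  induction T generalizing A B with
  | nil => cases A <;> cases B <;> simp [shuffles]
  | cons s T ih =>
    rcases A with _ | ⟨a, A⟩ <;> rcases B with _ | ⟨b, B⟩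
    · cases s <;> simp [shuffles]
    · rcases s with x | y
      · simp [shuffles]
      · have := ih (A := []) (B := B)
        simp only [shuffles_nil_left, Finset.mem_singleton] at this
        simp [shuffles_nil_left, this, and_left_comm]
    · rcases s with x | y
      · have := ih (A := A) (B := [])
        simp only [shuffles_nil_right, Finset.mem_singleton] at this
        simp [shuffles_nil_right, this, and_assoc]
      · simp [shuffles]
    · rcases s with x | y <;> simp [shuffles, ih, and_assoc, and_left_comm, eq_comm]

theorem card_shuffles (A : List α) (B : List β) :
    (shuffles A B).card = (A.length + B.length).choose A.length := by
  induction A, B using shuffles.induct with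
  | case1 B => simp [shuffles]
  | case2 a A => simp [shuffles]
  | case3 a A b B ihA ihB =>
    rw [shuffles, Finset.card_union_of_disjoint, Finset.card_map, Finset.card_map, ihA, ihB]
    · simp only [List.length_cons]
      rw [show A.length + 1 + (B.length + 1) = A.length + (B.length + 1) + 1 by ring,
        Nat.choose_succ_succ', add_right_comm _ 1, add_assoc]
    · simp [Finset.disjoint_left]

/-- The pairs of lists whose left entries are `X` and `Y`, respectively, and whose right entries
form `B` when put together. -/
def cutShuffles (X Y : List α) (B : List β) : Finset (List (α ⊕ β) × List (α ⊕ β)) :=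
  (antidiagonal B.length).biUnion fun p =>
    shuffles X (B.take p.1) ×ˢ shuffles Y (B.drop p.1)

theorem mem_cutShuffles {X Y : List α} {B : List β} {P : List (α ⊕ β) × List (α ⊕ β)} :
    P ∈ cutShuffles X Y B ↔ lefts P.1 = X ∧ lefts P.2 = Y ∧ rights P.1 ++ rights P.2 = B := by
  simp only [cutShuffles, Finset.mem_biUnion, mem_antidiagonal, Finset.mem_product,
    mem_shuffles]
  constructor
  · rintro ⟨p, -, ⟨hX, hB₁⟩, hY, hB₂⟩
    exact ⟨hX, hY, by rw [hB₁, hB₂, List.take_append_drop]⟩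
  · rintro ⟨hX, hY, rfl⟩
    exact ⟨((rights P.1).length, (rights P.2).length), by simp, by simpa, by simpa⟩

theorem card_cutShuffles (X Y : List α) (B : List β) :
    (cutShuffles X Y B).card =
      (X.length + Y.length + 1 + B.length).choose (X.length + Y.length + 1) := by
  rw [← sum_antidiagonal_choose_mul_choose, cutShuffles, Finset.card_biUnion]
  · refine Finset.sum_congr rfl fun p hp => ?_
    have hp := mem_antidiagonal.1 hp
    rw [Finset.card_product, card_shuffles, card_shuffles, List.length_take_of_le (by omega),
      List.length_drop, ← hp, Nat.add_sub_cancel_left]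
  · refine fun p hp p' hp' hne => Finset.disjoint_left.2 fun P hP hP' => hne ?_
    have hp := mem_antidiagonal.1 hp
    have hp' := mem_antidiagonal.1 hp'
    have h := (mem_shuffles.1 (Finset.mem_product.1 hP).1).2
    rw [(mem_shuffles.1 (Finset.mem_product.1 hP').1).2] at h
    have h := congrArg List.length h
    rw [List.length_take_of_le (by omega), List.length_take_of_le (by omega)] at h
    exact Prod.ext h.symm (by omega)

/-- The two lists that a pair of lists cuts in two and shuffles, the left one with its final part
first, together with the lengths of the initial and the final part of the left one. -/
def unshuffle (P : List (α ⊕ β) × List (α ⊕ β)) : (List α × List β) × ℕ × ℕ :=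
  ((lefts P.2 ++ lefts P.1, rights P.1 ++ rights P.2), (lefts P.2).length, (lefts P.1).length)

theorem mem_cutShuffles_drop_take {A : List α} {B : List β} {p : ℕ × ℕ}
    (hp : p ∈ antidiagonal A.length) {P : List (α ⊕ β) × List (α ⊕ β)} :
    P ∈ cutShuffles (A.drop p.1) (A.take p.1) B ↔ unshuffle P = ((A, B), p) := by
  have hp := mem_antidiagonal.1 hp
  rw [mem_cutShuffles, unshuffle, Prod.mk.injEq, Prod.mk.injEq]
  constructor
  · rintro ⟨hX, hY, hB⟩
    refine ⟨⟨by rw [hX, hY, List.take_append_drop], hB⟩, Prod.ext ?_ ?_⟩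
    · rw [hY, List.length_take_of_le (by omega)]
    · rw [hX, List.length_drop]
      omega
  · rintro ⟨⟨rfl, hB⟩, rfl⟩
    exact ⟨by simp, by simp, hB⟩

theorem card_cutShuffles_drop_take {A : List α} {B : List β} {p : ℕ × ℕ}
    (hp : p ∈ antidiagonal A.length) :
    (cutShuffles (A.drop p.1) (A.take p.1) B).card =
      (B.length + (A.length + 1)).choose (A.length + 1) := by
  have hp := mem_antidiagonal.1 hp
  rw [card_cutShuffles, List.length_drop, List.length_take_of_le (by omega),
    Nat.sub_add_cancel (by omega), add_comm B.length]

end Shuffles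

/-- The unshuffled form of the splittings of factorizations of `(0 1 ⋯ k)` and `(0 1 ⋯ n)`. -/
noncomputable def splittingData (k n : ℕ) : Finset ((List (ℕ × ℕ) × List (ℕ × ℕ)) × ℕ × ℕ) :=
  (arcFactorizations k ×ˢ arcFactorizations n) ×ˢ antidiagonal k

/-- The splittings of factorizations of `(0 1 ⋯ k)` and `(0 1 ⋯ n)`. -/
noncomputable def splittings (k n : ℕ) :
    Finset (List ((ℕ × ℕ) ⊕ (ℕ × ℕ)) × List ((ℕ × ℕ) ⊕ (ℕ × ℕ))) :=
  (splittingData k n).biUnion fun D => cutShuffles (D.1.1.drop D.2.1) (D.1.1.take D.2.1) D.1.2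

section Splittings

variable {k n : ℕ}

theorem mem_splittingData {D : (List (ℕ × ℕ) × List (ℕ × ℕ)) × ℕ × ℕ} :
    D ∈ splittingData k n ↔
      (IsMinFactorization k D.1.1 ∧ IsMinFactorization n D.1.2) ∧
        D.2 ∈ antidiagonal D.1.1.length := by
  simp only [splittingData, Finset.mem_product, mem_arcFactorizations]
  exact and_congr_right fun h => by rw [h.1.length_eq]

theorem mem_splittings {P : List ((ℕ × ℕ) ⊕ (ℕ × ℕ)) × List ((ℕ × ℕ) ⊕ (ℕ × ℕ))} :
    P ∈ splittings k n ↔ IsSplitting k n P.1 P.2 := by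
  rw [splittings, Finset.mem_biUnion]
  constructor
  · rintro ⟨D, hD, hP⟩
    obtain ⟨⟨hA, hB⟩, hp⟩ := mem_splittingData.1 hD
    obtain rfl : unshuffle P = D := (mem_cutShuffles_drop_take hp).1 hP
    exact ⟨hA, hB⟩
  · intro h
    have hp : (unshuffle P).2 ∈ antidiagonal (unshuffle P).1.1.length := by simp [unshuffle]
    exact ⟨unshuffle P, mem_splittingData.2 ⟨⟨h.left, h.right⟩, hp⟩,
      (mem_cutShuffles_drop_take hp).2 rfl⟩

theorem sum_splittings {M : Type*} [AddCommMonoid M] (k n : ℕ)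
    (f : (List (ℕ × ℕ) × List (ℕ × ℕ)) × ℕ × ℕ → M) :
    ∑ P ∈ splittings k n, f (unshuffle P) =
      (n + (k + 1)).choose (k + 1) • ∑ D ∈ splittingData k n, f D := by
  rw [splittings, Finset.sum_biUnion, Finset.smul_sum]
  · refine Finset.sum_congr rfl fun D hD => ?_
    obtain ⟨⟨hA, hB⟩, hp⟩ := mem_splittingData.1 hD
    rw [Finset.sum_congr rfl fun P hP => by rw [(mem_cutShuffles_drop_take hp).1 hP],
      Finset.sum_const, card_cutShuffles_drop_take hp, hA.length_eq, hB.length_eq]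
  · refine fun D hD D' hD' hne => Finset.disjoint_left.2 fun P hP hP' => hne ?_
    rw [mem_cutShuffles_drop_take (mem_splittingData.1 hD).2] at hP
    rw [mem_cutShuffles_drop_take (mem_splittingData.1 hD').2] at hP'
    exact hP.symm.trans hP'

end Splittings

/-! ### The recurrence -/

theorem IsMinFactorization.sum_trajectory_sub {R : Type*} [Ring R] {n : ℕ} {L : List (ℕ × ℕ)}
    (h : IsMinFactorization n L) :
    ∑ p ∈ Finset.range n, ((trajectory n L p : R) - trajectory n L (p + 1)) = n := by
  rw [Finset.sum_range_sub', trajectory_zero, h.trajectory_self, Nat.cast_zero, sub_zero]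

theorem mem_sigma_splittings {N k n : ℕ} {T₁ T₂ : List ((ℕ × ℕ) ⊕ (ℕ × ℕ))} :
    (⟨(k, n), T₁, T₂⟩ : Σ _ : ℕ × ℕ, _) ∈
        (antidiagonal N).sigma (fun m => splittings m.1 m.2) ↔
      n + k = N ∧ IsSplitting k n T₁ T₂ := by
  rw [Finset.mem_sigma, mem_antidiagonal, mem_splittings, add_comm]

theorem sum_trajectory_sub_mul {R : Type*} [Ring R] (N : ℕ) (g : List (ℕ × ℕ) → R) :
    ∑ L ∈ arcFactorizations (N + 1), ∑ p ∈ Finset.range (N + 1),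
        ((trajectory (N + 1) L p : R) - trajectory (N + 1) L (p + 1)) * g L =
      ∑ m ∈ antidiagonal N, ∑ P ∈ splittings m.1 m.2,
        ((m.1 + 1 : ℕ) : R) * g (glue m.1 m.2 P.1 P.2) := by
  rw [← Finset.sum_product', Finset.sum_sigma']
  symm
  refine Finset.sum_of_injOn (fun x => (glue x.1.1 x.1.2 x.2.1 x.2.2, x.2.1.length)) ?_ ?_ ?_ ?_
  · rintro ⟨⟨k, n⟩, T₁, T₂⟩ hx ⟨⟨k', n'⟩, T₁', T₂'⟩ hx' heq
    obtain ⟨hm, hT⟩ := mem_sigma_splittings.1 hx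
    obtain ⟨hm', hT'⟩ := mem_sigma_splittings.1 hx'
    obtain ⟨hglue, hlen⟩ := Prod.mk.inj heq
    obtain ⟨rfl, rfl, rfl, rfl⟩ := hT.glue_inj hT' (by omega) hlen hglue
    rfl
  · rintro ⟨⟨k, n⟩, T₁, T₂⟩ hx
    obtain ⟨rfl, hT⟩ := mem_sigma_splittings.1 hx
    exact Finset.mem_product.2
      ⟨mem_arcFactorizations.2 hT.isMinFactorization_glue, Finset.mem_range.2 hT.length_fst_lt⟩
  · rintro ⟨L, p⟩ hx hnot
    obtain ⟨hL, hp⟩ := Finset.mem_product.1 hx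
    rw [mem_arcFactorizations] at hL
    rw [Finset.mem_range] at hp
    by_cases hne : trajectory (N + 1) L (p + 1) = trajectory (N + 1) L p
    · rw [hne, sub_self, zero_mul]
    · obtain ⟨k, n, T₁, T₂, hN, hT, rfl, rfl⟩ := hL.exists_glue hp hne
      exact (hnot ⟨⟨(k, n), T₁, T₂⟩, mem_sigma_splittings.2 ⟨by omega, hT⟩, rfl⟩).elim
  · rintro ⟨⟨k, n⟩, T₁, T₂⟩ hx
    obtain ⟨rfl, hT⟩ := mem_sigma_splittings.1 hx
    dsimp only
    rw [add_assoc, hT.trajectory_glue, hT.trajectory_glue_succ, Nat.cast_add (arcProd _ _),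
      add_sub_cancel_left]

theorem qtNumber_succ (k : ℕ) : qtNumber (k + 1) = ∑ p ∈ antidiagonal k, t ^ p.1 * q ^ p.2 := by
  rw [← Finset.Nat.sum_antidiagonal_swap, Finset.Nat.sum_antidiagonal_eq_sum_range_succ_mk]
  rfl

theorem sum_weight_splittings (k n : ℕ) :
    ∑ P ∈ splittings k n, weight (n + (k + 1)) (glue k n P.1 P.2) =
      (n + (k + 1)).choose (k + 1) * (t * qtNumber (k + 1) * (F k * F n)) := by
  let f (D : (List (ℕ × ℕ) × List (ℕ × ℕ)) × ℕ × ℕ) : Coeff :=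
    weight k D.1.1 * weight n D.1.2 * (t ^ D.2.1 * q ^ D.2.2)
  have hglue : ∀ P ∈ splittings k n,
      weight (n + (k + 1)) (glue k n P.1 P.2) = t * f (unshuffle P) := fun P hP => by
    rw [(mem_splittings.1 hP).weight_glue]
    simp only [f, unshuffle]
    ring
  have hprod : ∑ D ∈ splittingData k n, f D = F k * F n * qtNumber (k + 1) := by
    rw [F_eq_sum_weight, F_eq_sum_weight, qtNumber_succ, Finset.sum_mul_sum,
      ← Finset.sum_product', Finset.sum_mul_sum, ← Finset.sum_product', splittingData]
  rw [Finset.sum_congr rfl hglue, ← Finset.mul_sum, sum_splittings, hprod, nsmul_eq_mul]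
  ring

theorem F_succ (N : ℕ) :
    F (N + 1) = ∑ m ∈ antidiagonal N,
      N.choose m.1 * (t * qtNumber (m.1 + 1) * F m.1 * F m.2) := by
  have htelescope : ((N + 1 : ℕ) : Coeff) * F (N + 1) =
      ∑ L ∈ arcFactorizations (N + 1), ∑ p ∈ Finset.range (N + 1),
        ((trajectory (N + 1) L p : Coeff) - trajectory (N + 1) L (p + 1)) *
          weight (N + 1) L := by
    rw [F_eq_sum_weight, Finset.mul_sum]
    refine Finset.sum_congr rfl fun L hL => ?_
    rw [← Finset.sum_mul, (mem_arcFactorizations.1 hL).sum_trajectory_sub]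
  have hne : ((N + 1 : ℕ) : Coeff) ≠ 0 := Nat.cast_ne_zero.2 N.succ_ne_zero
  refine mul_left_cancel₀ hne ?_
  rw [htelescope, sum_trajectory_sub_mul, Finset.mul_sum]
  refine Finset.sum_congr rfl fun m hm => ?_
  have hN : m.2 + (m.1 + 1) = N + 1 := by rw [← mem_antidiagonal.1 hm]; ring
  have hchoose : ((N + 1).choose (m.1 + 1) * (m.1 + 1 : ℕ) : Coeff) =
      (N + 1 : ℕ) * N.choose m.1 := by
    exact_mod_cast (N.add_one_mul_choose_eq m.1).symm
  rw [← Finset.mul_sum, ← hN, sum_weight_splittings, hN]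
  linear_combination t * qtNumber (m.1 + 1) * F m.1 * F m.2 * hchoose

theorem F_zero : F 0 = 1 := by
  have hnil : arcFactorizations 0 = {[]} := by
    ext L
    rw [mem_arcFactorizations, Finset.mem_singleton]
    constructor
    · exact fun h => List.length_eq_zero_iff.1 h.length_eq
    · rintro rfl
      exact ⟨rfl, by simp, by ext; simp [cycle_apply]⟩
  rw [F_eq_sum_weight, hnil]
  simp [weight, lowerArea, upperArea]

/-! ### The exponential formula -/

section ExponentialFormula

open PowerSeries
theorem derivative_egf (a : ℕ → Coeff) : d⁄dX Coeff (egf a) = egf fun n => a (n + 1) := by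
  ext1 n
  have hn : (n : Coeff) + 1 = MvPolynomial.C ((n : ℚ) + 1) := by simp
  rw [coeff_derivative, egf, egf, coeff_mk, coeff_mk, mul_comm, hn, ← MvPolynomial.smul_eq_C_mul,
    smul_smul, Nat.factorial_succ]
  congr 1
  push_cast
  field_simp

theorem egf_mul_egf (a b : ℕ → Coeff) :
    egf a * egf b = egf fun n => ∑ m ∈ antidiagonal n, n.choose m.1 * (a m.1 * b m.2) := by
  ext1 n
  simp only [egf, coeff_mul, coeff_mk, Finset.smul_sum]
  refine Finset.sum_congr rfl fun m hm => ?_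
  have hcast : ((n.choose m.1 : ℕ) : Coeff) = MvPolynomial.C (n.choose m.1 : ℚ) := by simp
  rw [hcast, ← MvPolynomial.smul_eq_C_mul, smul_mul_smul_comm, smul_smul,
    ← mem_antidiagonal.1 hm, Nat.cast_add_choose]
  congr 1
  field_simp

theorem C_mul_egf (r : Coeff) (a : ℕ → Coeff) : C r * egf a = egf fun n => r * a n := by
  ext1 n
  rw [coeff_C_mul, egf, egf, coeff_mk, coeff_mk, mul_smul_comm]

theorem derivative_egf_F : d⁄dX Coeff (egf F) = d⁄dX Coeff exponent * egf F := by
  rw [exponent, C_mul_egf, derivative_egf, derivative_egf, egf_mul_egf]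
  simp only [F_succ, mul_assoc, Nat.add_sub_cancel]

theorem eq_zero_of_derivative_eq_mul {R : Type*} [CommRing R] [IsDomain R] [CharZero R]
    {D E : PowerSeries R} (h : d⁄dX R D = E * D) (h0 : constantCoeff D = 0) : D = 0 := by
  ext1 n
  rw [map_zero]
  induction n using Nat.strong_induction_on with
  | _ n ih =>
  cases n with
  | zero => rwa [coeff_zero_eq_constantCoeff_apply]
  | succ n =>
    have hlower : ∀ m ∈ antidiagonal n, coeff m.1 E * coeff m.2 D = 0 := fun m hm => by
      rw [ih m.2 (by have := mem_antidiagonal.1 hm; omega), mul_zero]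
    have hcoeff := congrArg (coeff n) h
    rw [coeff_derivative, coeff_mul, Finset.sum_eq_zero hlower] at hcoeff
    exact (mul_eq_zero.1 hcoeff).resolve_right n.cast_add_one_ne_zero

theorem constantCoeff_exponent : constantCoeff exponent = 0 := by
  simp [exponent, egf, qtNumber]

theorem constantCoeff_exp_subst {A : Type*} [CommRing A] [Algebra ℚ A] {f : PowerSeries A}
    (hf : constantCoeff f = 0) : constantCoeff ((exp A).subst f : PowerSeries A) = 1 := by
  have h := constantCoeff_subst_eq_zero hf (exp A - 1) (by simp)
  rw [← coe_substAlgHom (.of_constantCoeff_zero hf), map_sub, map_one, map_sub, map_one,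
    coe_substAlgHom, sub_eq_zero] at h
  exact h

theorem egf_F_eq_exp : egf F = (exp Coeff).subst exponent := by
  refine sub_eq_zero.1 (eq_zero_of_derivative_eq_mul (E := d⁄dX Coeff exponent) ?_ ?_)
  · rw [map_sub, derivative_egf_F, derivative_subst hasSubst_exponent, derivative_exp]
    ring
  · have hF : constantCoeff (egf F) = 1 := by simp [egf, F_zero]
    rw [map_sub, hF, constantCoeff_exp_subst constantCoeff_exponent, sub_self]

end ExponentialFormula

end MinFact

theorem theorem4p1 :
    (∀ n : ℕ, ∀ f ∈ MinFact.minimalFactorizations n,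
      0 ≤ MinFact.areaL f ∧ 0 ≤ MinFact.areaU f) ∧
    MinFact.egf MinFact.F =
      ((PowerSeries.exp MinFact.Coeff).subst MinFact.exponent : PowerSeries MinFact.Coeff) := by
  refine ⟨fun n f hf => ?_, MinFact.egf_F_eq_exp⟩
  rw [MinFact.areaL_eq_lowerArea, MinFact.areaU_eq_upperArea]
  exact (MinFact.mem_minimalFactorizations.1 hf).2.area_nonneg
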